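/- Let $H$ be a complex Hilbert space and let $A\subseteq B(H)$ be an algebra of operators, i.e. a (not necessarily self-adjoint or closed) subalgebra of $B(H)$ containing the identity operator. On the algebraic tensor product $A\otimes A$ consider (1) the projective tensor norm $$\|u\|_{\gamma}=\inf\Big\{\sum_{i=1}^n\|a_i\|\,\|b_i\| \;:\; u=\sum_{i=1}^n a_i\otimes b_i,\ n\ge 0,\ a_i,b_i\in A\Big\};$$ (2) the operator space projective tensor norm $$\|u\|_{\wedge}=\inf\big\{\|\alpha\|\,\|x\|\,\|y\|\,\|\beta\| \;:\; u=\alpha(x\otimes y)\beta\big\},$$ where the infimum is over all $p,q\ge 0$, $x\in M_p(A)$, $y\in M_q(A)$, scalar rows $\alpha\in M_{1,pq}(\mathbb C)$ and scalar columns $\beta\in M_{pq,1}(\mathbb C)$; here $\alpha(x\otimes y)\beta=\sum_{i,j,k,l}\alpha_{(i,k)}\beta_{(j,l)}\,x_{ij}\otimes y_{kl}$, $\|\alpha\|,\|\beta\|$ are the $\ell^2$-norms, and $\|x\|,\|y\|$ are the operator norms of $x$ on $H^p$ and of $y$ on $H^q$. The projective and the operator space projective tensor products of $A$ with itself are the completions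 of $A\otimes A$ in these two norms. The product map $m(a\otimes b)=ab$ and, for each $a\in A$, the module actions $a\cdot(x\otimes y)=(ax)\otimes y$ and $(x\otimes y)\cdot a=x\otimes(ya)$ extend continuously to each completion, $m$ taking its values in the norm closure of $A$ in $B(H)$. A diagonal in such a completion is an element $u$ with $m(u)=1$ and $a\cdot u=u\cdot a$ for every $a\in A$. If there is a diagonal in either the projective or the operator space projective tensor product of $A$ with itself, then $A$ is finite dimensional. -/

import Mathlib

open scoped TensorProduct

set_option linter.unusedSectionVars false

noncomputable section

namespace OperatorAlgebraDiagonal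

variable {H : Type*} [NormedAddCommGroup H] [InnerProductSpace ℂ H]

/-! ### Elementary maps on the algebraic tensor product -/

/-- The usual additive group structure on `A ⊗ A`, given explicitly to shorten instance search. -/
instance instAddCommGroupTensor (A : Subalgebra ℂ (H →L[ℂ] H)) : AddCommGroup (A ⊗[ℂ] A) :=
  TensorProduct.addCommGroup

/-- The linear product map `A ⊗ A → B(H)`, `a ⊗ b ↦ a b`. -/
def productMap (A : Subalgebra ℂ (H →L[ℂ] H)) : A ⊗[ℂ] A →ₗ[ℂ] (H →L[ℂ] H) :=
  A.val.toLinearMap ∘ₗ LinearMap.mul' ℂ A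

/-- The left action of `a` on `A ⊗ A`: `x ⊗ y ↦ (a x) ⊗ y`. -/
def leftAction {A : Subalgebra ℂ (H →L[ℂ] H)} (a : A) : A ⊗[ℂ] A →ₗ[ℂ] A ⊗[ℂ] A :=
  LinearMap.rTensor A (LinearMap.mulLeft ℂ a)

/-- The right action of `a` on `A ⊗ A`: `x ⊗ y ↦ x ⊗ (y a)`. -/
def rightAction {A : Subalgebra ℂ (H →L[ℂ] H)} (a : A) : A ⊗[ℂ] A →ₗ[ℂ] A ⊗[ℂ] A :=
  LinearMap.lTensor A (LinearMap.mulRight ℂ a)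

@[simp] lemma productMap_tmul {A : Subalgebra ℂ (H →L[ℂ] H)} (x y : A) :
    productMap A (x ⊗ₜ y) = (x : H →L[ℂ] H) * y := by
  simp [productMap]

@[simp] lemma leftAction_tmul {A : Subalgebra ℂ (H →L[ℂ] H)} (a x y : A) :
    leftAction a (x ⊗ₜ y) = (a * x) ⊗ₜ y := by
  simp [leftAction]

@[simp] lemma rightAction_tmul {A : Subalgebra ℂ (H →L[ℂ] H)} (a x y : A) :
    rightAction a (x ⊗ₜ y) = x ⊗ₜ (y * a) := by
  simp [rightAction]

/-! ### Diagonals in the completion of `A ⊗ A` -/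

/-- A seminorm on `A ⊗ A` for which the product map is contractive and the two module actions of
`a` have norm at most `‖a‖`. These inequalities say exactly that the maps involved in the notion
of a diagonal extend to the completion; they are proved below for the two tensor norms. -/
structure ModuleSeminorm (A : Subalgebra ℂ (H →L[ℂ] H)) where
  /-- The underlying seminorm. -/
  toSeminorm : Seminorm ℂ (A ⊗[ℂ] A)
  norm_productMap_le : ∀ u, ‖productMap A u‖ ≤ toSeminorm u
  leftAction_le : ∀ (a : A) u, toSeminorm (leftAction a u) ≤ ‖a‖ * toSeminorm u
  rightAction_le : ∀ (a : A) u, toSeminorm (rightAction a u) ≤ ‖a‖ * toSeminorm u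

/-- The vector space `A ⊗ A`, regarded as a (semi)normed space with the seminorm `N`. -/
def NormedTensor {A : Subalgebra ℂ (H →L[ℂ] H)} (_N : ModuleSeminorm A) : Type _ := A ⊗[ℂ] A

namespace NormedTensor

variable {A : Subalgebra ℂ (H →L[ℂ] H)} (N : ModuleSeminorm A)

instance : SeminormedAddCommGroup (NormedTensor N) :=
  N.toSeminorm.toAddGroupSeminorm.toSeminormedAddCommGroup

instance : Module ℂ (NormedTensor N) := inferInstanceAs (Module ℂ (A ⊗[ℂ] A))

instance : NormedSpace ℂ (NormedTensor N) where
  norm_smul_le c u := (map_smul_eq_mul N.toSeminorm c u).le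

/-- The product map, as a bounded map on `A ⊗ A` with the norm `N`. -/
def productCLM : NormedTensor N →L[ℂ] (H →L[ℂ] H) :=
  LinearMap.mkContinuous (E := NormedTensor N) (productMap A) 1 fun u => by
    rw [one_mul]; exact N.norm_productMap_le u

/-- The left action of `a`, as a bounded map on `A ⊗ A` with the norm `N`. -/
def leftCLM (a : A) : NormedTensor N →L[ℂ] NormedTensor N :=
  LinearMap.mkContinuous (E := NormedTensor N) (F := NormedTensor N) (leftAction a) ‖a‖
    (N.leftAction_le a)

/-- The right action of `a`, as a bounded map on `A ⊗ A` with the norm `N`. -/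
def rightCLM (a : A) : NormedTensor N →L[ℂ] NormedTensor N :=
  LinearMap.mkContinuous (E := NormedTensor N) (F := NormedTensor N) (rightAction a) ‖a‖
    (N.rightAction_le a)

end NormedTensor

/-- The tensor product of `A` with itself for the norm `N`: the completion of `A ⊗ A`. -/
abbrev CompletedTensor {A : Subalgebra ℂ (H →L[ℂ] H)} (N : ModuleSeminorm A) : Type _ :=
  UniformSpace.Completion (NormedTensor N)

/-- `u` is a diagonal in the completed tensor product: the continuous extension of the product
map sends `u` to `1`, and `a · u = u · a` for every `a ∈ A`, where the actions are the continuous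
extensions of `x ⊗ y ↦ (a x) ⊗ y` and `x ⊗ y ↦ x ⊗ (y a)`. (`A` need not be closed, so the
extended product map takes its values in the closure of `A` in `B(H)`.) -/
def IsDiagonal [CompleteSpace H] {A : Subalgebra ℂ (H →L[ℂ] H)} (N : ModuleSeminorm A)
    (u : CompletedTensor N) : Prop :=
  (NormedTensor.productCLM N).fromCompletion u = 1 ∧
    ∀ a : A, (NormedTensor.leftCLM N a).completion u = (NormedTensor.rightCLM N a).completion u

/-! ### The projective tensor norm -/

lemma le_mul_csInf {S : Set ℝ} (hS : S.Nonempty) {b c : ℝ} (hc : 0 ≤ c)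
    (h : ∀ r ∈ S, b ≤ c * r) : b ≤ c * sInf S := by
  rw [← smul_eq_mul, ← Real.sInf_smul_of_nonneg hc]
  refine le_csInf hS.smul_set ?_
  rintro _ ⟨r, hr, rfl⟩
  exact h r hr

lemma csInf_le_mul_csInf {S T : Set ℝ} (hS : S.Nonempty) (hT : ∀ r ∈ T, 0 ≤ r) {c : ℝ}
    (hc : 0 ≤ c) (h : ∀ r ∈ S, ∃ t ∈ T, t ≤ c * r) : sInf T ≤ c * sInf S := by
  refine le_mul_csInf hS hc fun r hr => ?_
  obtain ⟨t, ht, htr⟩ := h r hr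
  exact (csInf_le ⟨0, hT⟩ ht).trans htr

section Projective

variable {A : Subalgebra ℂ (H →L[ℂ] H)}

/-- The values `∑ ‖aᵢ‖ ‖bᵢ‖` over all representations of `u` as a finite sum `∑ aᵢ ⊗ bᵢ`. -/
def projectiveValues (u : A ⊗[ℂ] A) : Set ℝ :=
  {r | ∃ (n : ℕ) (a b : Fin n → A), u = ∑ i, a i ⊗ₜ[ℂ] b i ∧ r = ∑ i, ‖a i‖ * ‖b i‖}

lemma projectiveValues_nonneg (u : A ⊗[ℂ] A) : ∀ r ∈ projectiveValues u, 0 ≤ r := by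
  rintro _ ⟨n, a, b, -, rfl⟩
  positivity

lemma projectiveValues_add {u v : A ⊗[ℂ] A} {r s : ℝ} (hr : r ∈ projectiveValues u)
    (hs : s ∈ projectiveValues v) : r + s ∈ projectiveValues (u + v) := by
  obtain ⟨n, a, b, rfl, rfl⟩ := hr
  obtain ⟨m, a', b', rfl, rfl⟩ := hs
  exact ⟨n + m, Fin.append a a', Fin.append b b', by simp [Fin.sum_univ_add],
    by simp [Fin.sum_univ_add]⟩

lemma projectiveValues_nonempty (u : A ⊗[ℂ] A) : (projectiveValues u).Nonempty := by
  induction u with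
  | zero => exact ⟨0, 0, Fin.elim0, Fin.elim0, by simp, by simp⟩
  | tmul x y => exact ⟨‖x‖ * ‖y‖, 1, fun _ => x, fun _ => y, by simp, by simp⟩
  | add u v hu hv =>
    obtain ⟨r, hr⟩ := hu
    obtain ⟨s, hs⟩ := hv
    exact ⟨r + s, projectiveValues_add hr hs⟩

/-- The projective tensor norm `inf {∑ ‖aᵢ‖ ‖bᵢ‖ : u = ∑ aᵢ ⊗ bᵢ}` on `A ⊗ A`. -/
def projectiveSeminorm (A : Subalgebra ℂ (H →L[ℂ] H)) : Seminorm ℂ (A ⊗[ℂ] A) :=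
  Seminorm.ofSMulLE (fun u => sInf (projectiveValues u))
    (le_antisymm
      (csInf_le ⟨0, projectiveValues_nonneg 0⟩ ⟨0, Fin.elim0, Fin.elim0, by simp, by simp⟩)
      (le_csInf (projectiveValues_nonempty 0) (projectiveValues_nonneg 0)))
    (fun u v => by
      refine le_of_forall_pos_le_add fun ε hε => ?_
      obtain ⟨r, hr, hr'⟩ := exists_lt_of_csInf_lt (projectiveValues_nonempty u)
        (lt_add_of_pos_right _ (half_pos hε))
      obtain ⟨s, hs, hs'⟩ := exists_lt_of_csInf_lt (projectiveValues_nonempty v)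
        (lt_add_of_pos_right _ (half_pos hε))
      have := csInf_le ⟨0, projectiveValues_nonneg _⟩ (projectiveValues_add hr hs)
      linarith)
    (fun c u => by
      refine csInf_le_mul_csInf (projectiveValues_nonempty u) (projectiveValues_nonneg _)
        (norm_nonneg c) ?_
      rintro _ ⟨n, a, b, rfl, rfl⟩
      refine ⟨_, ⟨n, fun i => c • a i, b, ?_, rfl⟩, le_of_eq ?_⟩
      · simp [Finset.smul_sum, TensorProduct.smul_tmul']
      · have h : ∀ x : A, ‖c • x‖ = ‖c‖ * ‖x‖ := fun x => norm_smul c (x : H →L[ℂ] H)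
        simp only [h, Finset.mul_sum, mul_assoc])

lemma projectiveSeminorm_apply (u : A ⊗[ℂ] A) :
    projectiveSeminorm A u = sInf (projectiveValues u) := rfl

/-- The projective tensor norm on `A ⊗ A`, with the bounds that let the product map and the module
actions extend to the projective tensor product. -/
def projectiveNorm (A : Subalgebra ℂ (H →L[ℂ] H)) : ModuleSeminorm A where
  toSeminorm := projectiveSeminorm A
  norm_productMap_le u := by
    refine le_csInf (projectiveValues_nonempty u) ?_
    rintro _ ⟨n, a, b, rfl, rfl⟩
    rw [map_sum]
    refine (norm_sum_le _ _).trans (Finset.sum_le_sum fun i _ => ?_)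
    rw [productMap_tmul]
    exact norm_mul_le _ _
  leftAction_le a u := by
    refine csInf_le_mul_csInf (projectiveValues_nonempty u) (projectiveValues_nonneg _)
      (norm_nonneg a) ?_
    rintro _ ⟨n, x, y, rfl, rfl⟩
    refine ⟨_, ⟨n, fun i => a * x i, y, by simp, rfl⟩, ?_⟩
    rw [Finset.mul_sum]
    refine Finset.sum_le_sum fun i _ => ?_
    rw [← mul_assoc]
    exact mul_le_mul_of_nonneg_right (norm_mul_le _ _) (norm_nonneg _)
  rightAction_le a u := by
    refine csInf_le_mul_csInf (projectiveValues_nonempty u) (projectiveValues_nonneg _)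
      (norm_nonneg a) ?_
    rintro _ ⟨n, x, y, rfl, rfl⟩
    refine ⟨_, ⟨n, x, fun i => y i * a, by simp, rfl⟩, ?_⟩
    rw [Finset.mul_sum]
    refine Finset.sum_le_sum fun i _ => ?_
    rw [mul_left_comm, mul_comm ‖a‖]
    exact mul_le_mul_of_nonneg_left (norm_mul_le _ _) (norm_nonneg _)

end Projective

/-! ### The operator space projective tensor norm -/

section MatrixNorm

variable {A : Subalgebra ℂ (H →L[ℂ] H)} {m n m' n' : Type*}
  [Fintype m] [Fintype n] [Fintype m'] [Fintype n']

/-- The operator `Hⁿ → Hᵐ` between Hilbert space direct sums given by an `m × n` matrix over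
`A ⊆ B(H)`: `(x v)ᵢ = ∑ⱼ xᵢⱼ vⱼ`. -/
def matrixOperator (x : Matrix m n A) :
    PiLp 2 (fun _ : n => H) →L[ℂ] PiLp 2 (fun _ : m => H) :=
  (PiLp.continuousLinearEquiv 2 ℂ (fun _ : m => H)).symm.toContinuousLinearMap ∘L
    ContinuousLinearMap.pi fun i => ∑ j, (x i j : H →L[ℂ] H) ∘L PiLp.proj 2 (fun _ : n => H) j

@[simp] lemma matrixOperator_apply (x : Matrix m n A) (v : PiLp 2 (fun _ : n => H)) (i : m) :
    matrixOperator x v i = ∑ j, (x i j : H →L[ℂ] H) (v j) := by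
  simp [matrixOperator]

/-- The operator space norm of a matrix over `A ⊆ B(H)`: its norm as an operator `Hⁿ → Hᵐ`. -/
def matrixNorm (x : Matrix m n A) : ℝ := ‖matrixOperator x‖

lemma matrixNorm_nonneg (x : Matrix m n A) : 0 ≤ matrixNorm x :=
  norm_nonneg (matrixOperator x)

lemma matrixNorm_spec (x : Matrix m n A) (v : n → H) :
    ∑ i, ‖∑ j, (x i j : H →L[ℂ] H) (v j)‖ ^ 2 ≤ matrixNorm x ^ 2 * ∑ j, ‖v j‖ ^ 2 := by
  have h := (matrixOperator x).le_opNorm (WithLp.toLp 2 v)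
  have h2 := pow_le_pow_left₀ (norm_nonneg _) h 2
  rw [mul_pow, PiLp.norm_sq_eq_of_L2, PiLp.norm_sq_eq_of_L2] at h2
  simpa [matrixNorm] using h2

lemma matrixNorm_le (x : Matrix m n A) {C : ℝ} (hC : 0 ≤ C)
    (h : ∀ v : n → H, ∑ i, ‖∑ j, (x i j : H →L[ℂ] H) (v j)‖ ^ 2 ≤ C ^ 2 * ∑ j, ‖v j‖ ^ 2) :
    matrixNorm x ≤ C := by
  refine ContinuousLinearMap.opNorm_le_bound _ hC fun v => ?_
  refine le_of_sq_le_sq ?_ (by positivity)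
  rw [mul_pow, PiLp.norm_sq_eq_of_L2, PiLp.norm_sq_eq_of_L2]
  simpa using h v.ofLp

lemma matrixNorm_smul_le (c : ℂ) (x : Matrix m n A) :
    matrixNorm (c • x) ≤ ‖c‖ * matrixNorm x := by
  refine matrixNorm_le _ (mul_nonneg (norm_nonneg _) (matrixNorm_nonneg _)) fun v => ?_
  have := mul_le_mul_of_nonneg_left (matrixNorm_spec x v) (sq_nonneg ‖c‖)
  simpa [← Finset.smul_sum, norm_smul, mul_pow, ← Finset.mul_sum, mul_assoc] using this

lemma matrixNorm_mul_left_le (a : A) (x : Matrix m n A) :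
    matrixNorm (Matrix.of fun i j => a * x i j) ≤ ‖a‖ * matrixNorm x := by
  refine matrixNorm_le _ (mul_nonneg (norm_nonneg _) (matrixNorm_nonneg _)) fun v => ?_
  have h := mul_le_mul_of_nonneg_left (matrixNorm_spec x v) (sq_nonneg ‖a‖)
  rw [mul_pow, mul_assoc]
  refine le_trans ?_ h
  rw [Finset.mul_sum]
  refine Finset.sum_le_sum fun i _ => ?_
  rw [← mul_pow]
  refine pow_le_pow_left₀ (norm_nonneg _) ?_ 2
  refine le_of_eq_of_le ?_ ((a : H →L[ℂ] H).le_opNorm (∑ j, (x i j : H →L[ℂ] H) (v j)))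
  rw [map_sum]
  rfl

lemma matrixNorm_mul_right_le (a : A) (x : Matrix m n A) :
    matrixNorm (Matrix.of fun i j => x i j * a) ≤ ‖a‖ * matrixNorm x := by
  refine matrixNorm_le _ (mul_nonneg (norm_nonneg _) (matrixNorm_nonneg _)) fun v => ?_
  have h := matrixNorm_spec x fun j => (a : H →L[ℂ] H) (v j)
  have h2 : ∑ j, ‖(a : H →L[ℂ] H) (v j)‖ ^ 2 ≤ ‖a‖ ^ 2 * ∑ j, ‖v j‖ ^ 2 := by
    rw [Finset.mul_sum]
    refine Finset.sum_le_sum fun i _ => ?_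
    rw [← mul_pow]
    exact pow_le_pow_left₀ (norm_nonneg _) ((a : H →L[ℂ] H).le_opNorm _) 2
  have h3 := h.trans (mul_le_mul_of_nonneg_left h2 (sq_nonneg (matrixNorm x)))
  calc _ = _ := by simp
    _ ≤ _ := h3
    _ = _ := by ring

lemma matrixNorm_reindex_le (e : m ≃ m') (f : n ≃ n') (x : Matrix m n A) :
    matrixNorm (Matrix.reindex e f x) ≤ matrixNorm x := by
  refine matrixNorm_le _ (matrixNorm_nonneg _) fun v => ?_
  have h := matrixNorm_spec x (v ∘ f)
  rw [← Equiv.sum_comp e, ← Equiv.sum_comp f]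
  refine le_trans (le_of_eq ?_) h
  refine Finset.sum_congr rfl fun i _ => ?_
  rw [← Equiv.sum_comp f]
  simp

lemma matrixNorm_fromBlocks_le (x : Matrix m n A) (y : Matrix m' n' A) {C : ℝ} (hC : 0 ≤ C)
    (hx : matrixNorm x ≤ C) (hy : matrixNorm y ≤ C) :
    matrixNorm (Matrix.fromBlocks x 0 0 y) ≤ C := by
  refine matrixNorm_le _ hC fun v => ?_
  have h1 := (matrixNorm_spec x (v ∘ Sum.inl)).trans (mul_le_mul_of_nonneg_right
    (pow_le_pow_left₀ (matrixNorm_nonneg x) hx 2) (by positivity))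
  have h2 := (matrixNorm_spec y (v ∘ Sum.inr)).trans (mul_le_mul_of_nonneg_right
    (pow_le_pow_left₀ (matrixNorm_nonneg y) hy 2) (by positivity))
  simp only [Fintype.sum_sum_type, Matrix.fromBlocks_apply₁₁, Matrix.fromBlocks_apply₁₂,
    Matrix.fromBlocks_apply₂₁, Matrix.fromBlocks_apply₂₂, Matrix.zero_apply,
    ZeroMemClass.coe_zero, zero_apply, Finset.sum_const_zero, add_zero,
    zero_add, mul_add]
  exact add_le_add h1 h2

end MatrixNorm

section OperatorProjective

variable {A : Subalgebra ℂ (H →L[ℂ] H)} {m n m' n' : Type*}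
  [Fintype m] [Fintype n] [Fintype m'] [Fintype n']

/-- The element `α (x ⊗ y) β` of `A ⊗ A`, where `α` is a row and `β` a column of scalars indexed
by `m × n`, and `x ⊗ y` is the Kronecker product of the square matrices `x` and `y` over `A`. -/
def rowKroneckerColumn (α : EuclideanSpace ℂ (m × n)) (x : Matrix m m A) (y : Matrix n n A)
    (β : EuclideanSpace ℂ (m × n)) : A ⊗[ℂ] A :=
  ∑ s : m × n, ∑ t : m × n, (α s * β t) • (x s.1 t.1 ⊗ₜ[ℂ] y s.2 t.2)

/-- The values `‖α‖ ‖x‖ ‖y‖ ‖β‖` over all representations `u = α (x ⊗ y) β` with `x ∈ M_p(A)`,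
`y ∈ M_q(A)`, a row `α` and a column `β` of `p q` scalars. -/
def operatorProjectiveValues (u : A ⊗[ℂ] A) : Set ℝ :=
  {r | ∃ (p q : ℕ) (α β : EuclideanSpace ℂ (Fin p × Fin q)) (x : Matrix (Fin p) (Fin p) A)
    (y : Matrix (Fin q) (Fin q) A), u = rowKroneckerColumn α x y β ∧
      r = ‖α‖ * matrixNorm x * matrixNorm y * ‖β‖}

lemma operatorProjectiveValues_nonneg (u : A ⊗[ℂ] A) :
    ∀ r ∈ operatorProjectiveValues u, 0 ≤ r := by
  rintro _ ⟨p, q, α, β, x, y, -, rfl⟩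
  have := matrixNorm_nonneg x
  have := matrixNorm_nonneg y
  positivity

lemma rowKroneckerColumn_reindex (e : m ≃ m') (f : n ≃ n') (α : EuclideanSpace ℂ (m × n))
    (x : Matrix m m A) (y : Matrix n n A) (β : EuclideanSpace ℂ (m × n)) :
    rowKroneckerColumn (WithLp.toLp 2 (α.ofLp ∘ (e.prodCongr f).symm)) (Matrix.reindex e e x)
      (Matrix.reindex f f y) (WithLp.toLp 2 (β.ofLp ∘ (e.prodCongr f).symm)) =
    rowKroneckerColumn α x y β := by
  unfold rowKroneckerColumn
  rw [← Equiv.sum_comp (e.prodCongr f)]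
  refine Finset.sum_congr rfl fun s _ => ?_
  rw [← Equiv.sum_comp (e.prodCongr f)]
  refine Finset.sum_congr rfl fun t _ => ?_
  simp [Prod.map]

lemma norm_toLp_comp_equiv_symm (e : m ≃ n) (α : EuclideanSpace ℂ m) :
    ‖(WithLp.toLp 2 (α.ofLp ∘ e.symm) : EuclideanSpace ℂ n)‖ = ‖α‖ := by
  rw [EuclideanSpace.norm_eq, EuclideanSpace.norm_eq]
  congr 1
  exact Equiv.sum_comp e.symm fun i => ‖α.ofLp i‖ ^ 2

/-- Representations over arbitrary finite index types give values too. -/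
lemma exists_operatorProjectiveValues_le {m n : Type} [Fintype m] [Fintype n]
    (α β : EuclideanSpace ℂ (m × n)) (x : Matrix m m A) (y : Matrix n n A) :
    ∃ r ∈ operatorProjectiveValues (rowKroneckerColumn α x y β),
      r ≤ ‖α‖ * matrixNorm x * matrixNorm y * ‖β‖ := by
  refine ⟨_, ⟨_, _, _, _, _, _,
    (rowKroneckerColumn_reindex (Fintype.equivFin m) (Fintype.equivFin n) α x y β).symm, rfl⟩, ?_⟩
  rw [norm_toLp_comp_equiv_symm, norm_toLp_comp_equiv_symm]
  have h1 := matrixNorm_reindex_le (Fintype.equivFin m) (Fintype.equivFin m) x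
  have h2 := matrixNorm_reindex_le (Fintype.equivFin n) (Fintype.equivFin n) y
  have := matrixNorm_nonneg x
  have := matrixNorm_nonneg (Matrix.reindex (Fintype.equivFin n) (Fintype.equivFin n) y)
  gcongr

/-- A value below `t` can be balanced: `‖x‖, ‖y‖ ≤ 1` and `‖α‖, ‖β‖ ≤ √t`. -/
lemma exists_balanced {u : A ⊗[ℂ] A} {r t : ℝ} (hr : r ∈ operatorProjectiveValues u)
    (hrt : r < t) :
    ∃ (p q : ℕ) (α β : EuclideanSpace ℂ (Fin p × Fin q)) (x : Matrix (Fin p) (Fin p) A)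
      (y : Matrix (Fin q) (Fin q) A), u = rowKroneckerColumn α x y β ∧
      ‖α‖ ^ 2 ≤ t ∧ ‖β‖ ^ 2 ≤ t ∧ matrixNorm x ≤ 1 ∧ matrixNorm y ≤ 1 := by
  obtain ⟨p, q, α, β, x, y, rfl, rfl⟩ := hr
  have hcont : Filter.Tendsto (fun ε : ℝ => (‖α‖ + ε) * (matrixNorm x + ε) * (matrixNorm y + ε) *
      (‖β‖ + ε)) (nhdsWithin 0 (Set.Ioi 0)) (nhds (‖α‖ * matrixNorm x * matrixNorm y * ‖β‖)) := by
    refine tendsto_nhdsWithin_of_tendsto_nhds (Continuous.tendsto' (by fun_prop) _ _ (by simp))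
  obtain ⟨ε, hε, hε0⟩ :=
    ((hcont.eventually_lt_const hrt).and self_mem_nhdsWithin).exists
  have hε0 : 0 < ε := hε0
  have hX := matrixNorm_nonneg x
  have hY := matrixNorm_nonneg y
  obtain ⟨a, ha⟩ : ∃ a, a = ‖α‖ + ε := ⟨_, rfl⟩
  obtain ⟨b, hb⟩ : ∃ b, b = ‖β‖ + ε := ⟨_, rfl⟩
  obtain ⟨X, hX'⟩ : ∃ X, X = matrixNorm x + ε := ⟨_, rfl⟩
  obtain ⟨Y, hY'⟩ : ∃ Y, Y = matrixNorm y + ε := ⟨_, rfl⟩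
  rw [← ha, ← hb, ← hX', ← hY'] at hε
  have ha0 : 0 < a := by rw [ha]; positivity
  have hb0 : 0 < b := by rw [hb]; positivity
  have hX0 : 0 < X := by rw [hX']; positivity
  have hY0 : 0 < Y := by rw [hY']; positivity
  obtain ⟨w, hw⟩ : ∃ w, w = Real.sqrt (a * X * Y * b) := ⟨_, rfl⟩
  have hw0 : 0 < w := by rw [hw]; positivity
  have hw2 : w ^ 2 = a * X * Y * b := by rw [hw]; exact Real.sq_sqrt (by positivity)
  refine ⟨p, q, ((w / a : ℝ) : ℂ) • α, ((w / b : ℝ) : ℂ) • β, ((X⁻¹ : ℝ) : ℂ) • x,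
    ((Y⁻¹ : ℝ) : ℂ) • y, ?_, ?_, ?_, ?_, ?_⟩
  · unfold rowKroneckerColumn
    refine Finset.sum_congr rfl fun s _ => Finset.sum_congr rfl fun t _ => ?_
    simp only [PiLp.smul_apply, Matrix.smul_apply, smul_eq_mul, ← TensorProduct.smul_tmul',
      TensorProduct.tmul_smul, smul_smul]
    congr 1
    have : ((w / a : ℝ) : ℂ) * ((w / b : ℝ) : ℂ) * ((X⁻¹ : ℝ) : ℂ) * ((Y⁻¹ : ℝ) : ℂ) = 1 := by
      norm_cast
      field_simp
      rw [hw2]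
      ring
    linear_combination (-(α s * β t)) * this
  · rw [norm_smul, mul_pow, Complex.norm_real, Real.norm_of_nonneg (by positivity)]
    have h : ‖α‖ ^ 2 ≤ a ^ 2 := pow_le_pow_left₀ (norm_nonneg _) (by linarith) 2
    calc (w / a) ^ 2 * ‖α‖ ^ 2 ≤ (w / a) ^ 2 * a ^ 2 := by gcongr
      _ = w ^ 2 := by field_simp
      _ ≤ t := by rw [hw2]; exact hε.le
  · rw [norm_smul, mul_pow, Complex.norm_real, Real.norm_of_nonneg (by positivity)]
    have h : ‖β‖ ^ 2 ≤ b ^ 2 := pow_le_pow_left₀ (norm_nonneg _) (by linarith) 2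
    calc (w / b) ^ 2 * ‖β‖ ^ 2 ≤ (w / b) ^ 2 * b ^ 2 := by gcongr
      _ = w ^ 2 := by field_simp
      _ ≤ t := by rw [hw2]; exact hε.le
  · refine (matrixNorm_smul_le _ _).trans ?_
    rw [Complex.norm_real, Real.norm_of_nonneg (by positivity), inv_mul_le_iff₀ hX0]
    linarith
  · refine (matrixNorm_smul_le _ _).trans ?_
    rw [Complex.norm_real, Real.norm_of_nonneg (by positivity), inv_mul_le_iff₀ hY0]
    linarith

/-- The direct sum of two rows, supported on the diagonal blocks of `(m ⊕ m') × (n ⊕ n')`. -/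
def blockVector (α : EuclideanSpace ℂ (m × n)) (α' : EuclideanSpace ℂ (m' × n')) :
    EuclideanSpace ℂ ((m ⊕ m') × (n ⊕ n')) :=
  WithLp.toLp 2 fun s => match s with
    | (Sum.inl i, Sum.inl k) => α (i, k)
    | (Sum.inr i, Sum.inr k) => α' (i, k)
    | _ => 0

lemma norm_blockVector_sq (α : EuclideanSpace ℂ (m × n)) (α' : EuclideanSpace ℂ (m' × n')) :
    ‖blockVector α α'‖ ^ 2 = ‖α‖ ^ 2 + ‖α'‖ ^ 2 := by
  simp [EuclideanSpace.norm_sq_eq, Fintype.sum_prod_type, blockVector]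

lemma rowKroneckerColumn_block (α β : EuclideanSpace ℂ (m × n)) (x : Matrix m m A)
    (y : Matrix n n A) (α' β' : EuclideanSpace ℂ (m' × n')) (x' : Matrix m' m' A)
    (y' : Matrix n' n' A) :
    rowKroneckerColumn (blockVector α α') (Matrix.fromBlocks x 0 0 x')
      (Matrix.fromBlocks y 0 0 y') (blockVector β β') =
    rowKroneckerColumn α x y β + rowKroneckerColumn α' x' y' β' := by
  simp [rowKroneckerColumn, Fintype.sum_prod_type, blockVector]

lemma exists_operatorProjectiveValues_add {u v : A ⊗[ℂ] A} {r s t t' : ℝ}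
    (hr : r ∈ operatorProjectiveValues u) (hs : s ∈ operatorProjectiveValues v)
    (hrt : r < t) (hst : s < t') :
    ∃ w ∈ operatorProjectiveValues (u + v), w ≤ t + t' := by
  obtain ⟨p, q, α, β, x, y, rfl, hα, hβ, hx, hy⟩ := exists_balanced hr hrt
  obtain ⟨p', q', α', β', x', y', rfl, hα', hβ', hx', hy'⟩ := exists_balanced hs hst
  rw [← rowKroneckerColumn_block]
  obtain ⟨w, hw, hle⟩ := exists_operatorProjectiveValues_le (blockVector α α') (blockVector β β')
    (Matrix.fromBlocks x 0 0 x') (Matrix.fromBlocks y 0 0 y')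
  refine ⟨w, hw, hle.trans ?_⟩
  have h1 := matrixNorm_fromBlocks_le x x' zero_le_one hx hx'
  have h2 := matrixNorm_fromBlocks_le y y' zero_le_one hy hy'
  have h3 := norm_blockVector_sq α α'
  have h4 := norm_blockVector_sq β β'
  have h5 := matrixNorm_nonneg (Matrix.fromBlocks y 0 0 y')
  calc _ ≤ ‖blockVector α α'‖ * 1 * 1 * ‖blockVector β β'‖ := by gcongr
    _ ≤ t + t' := by
      nlinarith [sq_nonneg (‖blockVector α α'‖ - ‖blockVector β β'‖)]

lemma operatorProjectiveValues_nonempty (u : A ⊗[ℂ] A) :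
    (operatorProjectiveValues u).Nonempty := by
  induction u with
  | zero => exact ⟨_, 0, 0, 0, 0, 0, 0, by simp [rowKroneckerColumn], rfl⟩
  | tmul x y =>
    exact ⟨_, 1, 1, WithLp.toLp 2 fun _ => 1, WithLp.toLp 2 fun _ => 1, Matrix.of fun _ _ => x,
      Matrix.of fun _ _ => y, by simp [rowKroneckerColumn], rfl⟩
  | add u v hu hv =>
    obtain ⟨r, hr⟩ := hu
    obtain ⟨s, hs⟩ := hv
    obtain ⟨w, hw, -⟩ := exists_operatorProjectiveValues_add hr hs (lt_add_one r) (lt_add_one s)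
    exact ⟨w, hw⟩

/-- The operator space projective tensor norm
`inf {‖α‖ ‖x‖ ‖y‖ ‖β‖ : u = α (x ⊗ y) β}` on `A ⊗ A`. -/
def operatorProjectiveSeminorm (A : Subalgebra ℂ (H →L[ℂ] H)) : Seminorm ℂ (A ⊗[ℂ] A) :=
  Seminorm.ofSMulLE (fun u => sInf (operatorProjectiveValues u))
    (le_antisymm
      (csInf_le ⟨0, operatorProjectiveValues_nonneg 0⟩
        ⟨0, 0, 0, 0, 0, 0, by simp [rowKroneckerColumn], by simp⟩)
      (le_csInf (operatorProjectiveValues_nonempty 0) (operatorProjectiveValues_nonneg 0)))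
    (fun u v => by
      refine le_of_forall_pos_le_add fun ε hε => ?_
      obtain ⟨r, hr, hr'⟩ := exists_lt_of_csInf_lt (operatorProjectiveValues_nonempty u)
        (lt_add_of_pos_right _ (half_pos hε))
      obtain ⟨s, hs, hs'⟩ := exists_lt_of_csInf_lt (operatorProjectiveValues_nonempty v)
        (lt_add_of_pos_right _ (half_pos hε))
      obtain ⟨w, hw, hle⟩ := exists_operatorProjectiveValues_add hr hs hr' hs'
      have := csInf_le ⟨0, operatorProjectiveValues_nonneg _⟩ hw
      linarith)
    (fun c u => by
      refine csInf_le_mul_csInf (operatorProjectiveValues_nonempty u)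
        (operatorProjectiveValues_nonneg _) (norm_nonneg c) ?_
      rintro _ ⟨p, q, α, β, x, y, rfl, rfl⟩
      refine ⟨_, ⟨p, q, c • α, β, x, y, ?_, rfl⟩, le_of_eq ?_⟩
      · simp [rowKroneckerColumn, Finset.smul_sum, smul_smul, mul_assoc]
      · rw [norm_smul]; ring)

lemma operatorProjectiveSeminorm_apply (u : A ⊗[ℂ] A) :
    operatorProjectiveSeminorm A u = sInf (operatorProjectiveValues u) := rfl

lemma norm_productMap_rowKroneckerColumn_le (α β : EuclideanSpace ℂ (m × n)) (x : Matrix m m A)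
    (y : Matrix n n A) : ‖productMap A (rowKroneckerColumn α x y β)‖ ≤
      ‖α‖ * matrixNorm x * matrixNorm y * ‖β‖ := by
  have hX := matrixNorm_nonneg x
  have hY := matrixNorm_nonneg y
  refine ContinuousLinearMap.opNorm_le_bound _ (by positivity) fun v => ?_
  set z : m → n → H := fun j k => ∑ l, (y k l : H →L[ℂ] H) (β (j, l) • v) with hz
  set t : m × n → H := fun s => ∑ j, (x s.1 j : H →L[ℂ] H) (z j s.2) with ht
  have h1 : productMap A (rowKroneckerColumn α x y β) v = ∑ s, α s • t s := by
    simp only [rowKroneckerColumn, map_sum, map_smul, productMap_tmul,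
      sum_apply, smul_apply, ht, hz]
    refine Finset.sum_congr rfl fun s _ => ?_
    rw [Fintype.sum_prod_type, Finset.smul_sum]
    refine Finset.sum_congr rfl fun j _ => ?_
    rw [Finset.smul_sum]
    refine Finset.sum_congr rfl fun l _ => ?_
    rw [mul_smul]
    rfl
  have h2 : ∀ j, ∑ k, ‖z j k‖ ^ 2 ≤ matrixNorm y ^ 2 * ∑ l, ‖β (j, l) • v‖ ^ 2 :=
    fun j => matrixNorm_spec y fun l => β (j, l) • v
  have h3 : ∑ j, ∑ k, ‖z j k‖ ^ 2 ≤ matrixNorm y ^ 2 * (‖β‖ ^ 2 * ‖v‖ ^ 2) := by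
    refine (Finset.sum_le_sum fun j _ => h2 j).trans (le_of_eq ?_)
    rw [← Finset.mul_sum, EuclideanSpace.norm_sq_eq, Fintype.sum_prod_type]
    simp only [norm_smul, mul_pow, Finset.sum_mul]
  have h4 : ∑ s, ‖t s‖ ^ 2 ≤ matrixNorm x ^ 2 * ∑ j, ∑ k, ‖z j k‖ ^ 2 := by
    rw [Fintype.sum_prod_type_right, Finset.sum_comm (s := (Finset.univ : Finset m)), Finset.mul_sum]
    exact Finset.sum_le_sum fun k _ => matrixNorm_spec x fun j => z j k
  have h5 : ∑ s, ‖t s‖ ^ 2 ≤ (matrixNorm x * matrixNorm y * ‖β‖ * ‖v‖) ^ 2 := by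
    refine h4.trans ((mul_le_mul_of_nonneg_left h3 (sq_nonneg _)).trans (le_of_eq ?_))
    ring
  rw [h1]
  refine (norm_sum_le _ _).trans ?_
  simp only [norm_smul]
  refine le_of_sq_le_sq ?_ (by positivity)
  refine (Finset.sum_mul_sq_le_sq_mul_sq _ _ _).trans ?_
  rw [← EuclideanSpace.norm_sq_eq]
  refine (mul_le_mul_of_nonneg_left h5 (sq_nonneg _)).trans (le_of_eq ?_)
  ring

/-- The operator space projective tensor norm on `A ⊗ A`, with the bounds that let the product map
and the module actions extend to the operator space projective tensor product. -/
def operatorProjectiveNorm (A : Subalgebra ℂ (H →L[ℂ] H)) : ModuleSeminorm A where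
  toSeminorm := operatorProjectiveSeminorm A
  norm_productMap_le u := by
    refine le_csInf (operatorProjectiveValues_nonempty u) ?_
    rintro _ ⟨p, q, α, β, x, y, rfl, rfl⟩
    exact norm_productMap_rowKroneckerColumn_le α β x y
  leftAction_le a u := by
    refine csInf_le_mul_csInf (operatorProjectiveValues_nonempty u)
      (operatorProjectiveValues_nonneg _) (norm_nonneg a) ?_
    rintro _ ⟨p, q, α, β, x, y, rfl, rfl⟩
    refine ⟨_, ⟨p, q, α, β, Matrix.of fun i j => a * x i j, y, ?_, rfl⟩, ?_⟩
    · simp [rowKroneckerColumn]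
    · have h := matrixNorm_mul_left_le a x
      have hy := matrixNorm_nonneg y
      calc _ ≤ ‖α‖ * (‖a‖ * matrixNorm x) * matrixNorm y * ‖β‖ := by gcongr
        _ = _ := by ring
  rightAction_le a u := by
    refine csInf_le_mul_csInf (operatorProjectiveValues_nonempty u)
      (operatorProjectiveValues_nonneg _) (norm_nonneg a) ?_
    rintro _ ⟨p, q, α, β, x, y, rfl, rfl⟩
    refine ⟨_, ⟨p, q, α, β, x, Matrix.of fun i j => y i j * a, ?_, rfl⟩, ?_⟩
    · simp [rowKroneckerColumn]
    · have h := matrixNorm_mul_right_le a y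
      have hx := matrixNorm_nonneg x
      calc _ ≤ ‖α‖ * matrixNorm x * (‖a‖ * matrixNorm y) * ‖β‖ := by gcongr
        _ = _ := by ring

end OperatorProjective

end OperatorAlgebraDiagonal

end

open scoped TensorProduct InnerProductSpace

noncomputable section

namespace OperatorAlgebraDiagonal

/-! ### Square-summable rows and columns of operators -/

section RowColumn

variable {H : Type*} [NormedAddCommGroup H] [InnerProductSpace ℂ H] {ι : Type*}

/-! Both norms dominate the Haagerup norm, and this is all the argument uses. A diagonal `u` can
therefore be written as `∑ aᵢ ⊗ bᵢ` with `(aᵢ)` a bounded row and `∑ bᵢ* bᵢ` norm convergent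
(`DominatesHaagerup.exists_series`), and the slices `S_{ξ,η}(a ⊗ b) = ⟪η, b ξ⟫ a` extend to the
completion.

Let `X` be the space of operators `x` for which `a ↦ a x` is a norm limit of finite rank maps on
`A`. It is a closed right ideal of `B(H)`. Every slice of `u` lies in it, because `a S_{ξ,η}(u) =
S_{ξ,η}(a · u) = S_{ξ,η}(u · a) = S_{aξ,η}(u)`: replacing `u` by a nearby algebraic tensor makes the
right side a finite rank function of `a`, with error at most a small multiple of `‖a‖`
(`slice_mem_approximableSubmodule`).

The crux is to pass from slices to the product `m(u) = ∑ aᵢ bᵢ` (`IsBoundedRow.product_mem`). The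
vectors `c` in `ℓ²` with `∑ cᵢ aᵢ ∈ X` form a closed subspace `K`, with orthogonal projection `P`.
All slices lying in `X` means that `P ⊗ 1` fixes the column `b`. Hence `m(u)` is approximated by
finite sums `∑ a(P eᵢ) bᵢ`, where `a(c) = ∑ cⱼ aⱼ`; these lie in `X`, since `a(P eᵢ)` does and `X`
is a right ideal.

So `1 = m(u) ∈ X`: the inclusion of `A` in `B(H)` is close to a finite rank map, which must be
injective, and `A` is finite dimensional. -/

/-- `a` is a bounded row of operators: `‖∑ aᵢ wᵢ‖² ≤ M ∑ ‖wᵢ‖²`. -/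
def IsBoundedRow (M : ℝ) (a : ι → H →L[ℂ] H) : Prop :=
  ∀ (s : Finset ι) (w : ι → H), ‖∑ i ∈ s, a i (w i)‖ ^ 2 ≤ M * ∑ i ∈ s, ‖w i‖ ^ 2

/-- `b` is a column of operators for which `∑ bᵢ* bᵢ` converges in norm. -/
def IsVanishingColumn (b : ι → H →L[ℂ] H) : Prop :=
  ∀ ε > 0, ∃ F : Finset ι, ∀ s : Finset ι, Disjoint s F →
    ∀ ξ, ∑ i ∈ s, ‖b i ξ‖ ^ 2 ≤ ε * ‖ξ‖ ^ 2

lemma lp_two_hasSum_sq (x : lp (fun _ : ι => ℂ) 2) :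
    HasSum (fun i => ‖x i‖ ^ 2) (‖x‖ ^ 2) := by
  simpa using lp.hasSum_norm (p := 2) (by simp) x

lemma lp_two_sum_sq_le (x : lp (fun _ : ι => ℂ) 2) (s : Finset ι) :
    ∑ i ∈ s, ‖x i‖ ^ 2 ≤ ‖x‖ ^ 2 :=
  sum_le_hasSum s (fun _ _ => sq_nonneg _) (lp_two_hasSum_sq x)

lemma IsBoundedRow.norm_sum_smul_sq_le {M : ℝ} {a : ι → H →L[ℂ] H} (hM : 0 ≤ M)
    (ha : IsBoundedRow M a) (s : Finset ι) (c : ι → ℂ) :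
    ‖∑ i ∈ s, c i • a i‖ ^ 2 ≤ M * ∑ i ∈ s, ‖c i‖ ^ 2 := by
  have h0 : 0 ≤ M * ∑ i ∈ s, ‖c i‖ ^ 2 := by positivity
  refine Real.le_sqrt (norm_nonneg _) h0 |>.mp ?_
  refine ContinuousLinearMap.opNorm_le_bound _ (Real.sqrt_nonneg _) fun ξ => ?_
  refine le_of_sq_le_sq ?_ (by positivity)
  rw [mul_pow, Real.sq_sqrt h0]
  have h := ha s fun i => c i • ξ
  simpa [norm_smul, mul_pow, ← Finset.sum_mul, mul_assoc] using h

lemma IsVanishingColumn.summable {b : ι → H →L[ℂ] H} (hb : IsVanishingColumn b) (ξ : H) :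
    Summable fun i => ‖b i ξ‖ ^ 2 := by
  rw [summable_iff_vanishing_norm]
  intro ε hε
  obtain ⟨F, hF⟩ := hb (ε / (‖ξ‖ ^ 2 + 1)) (by positivity)
  refine ⟨F, fun s hs => ?_⟩
  rw [Real.norm_of_nonneg (by positivity)]
  refine (hF s hs ξ).trans_lt ?_
  rw [div_mul_eq_mul_div, div_lt_iff₀ (by positivity)]
  nlinarith [sq_nonneg ‖ξ‖]

variable [CompleteSpace H]

lemma IsBoundedRow.summable_smul {M : ℝ} {a : ι → H →L[ℂ] H} (hM : 0 ≤ M)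
    (ha : IsBoundedRow M a) {c : ι → ℂ} (hc : Summable fun i => ‖c i‖ ^ 2) :
    Summable fun i => c i • a i := by
  rw [summable_iff_vanishing_norm]
  intro ε hε
  obtain ⟨F, hF⟩ := summable_iff_vanishing_norm.mp hc (ε ^ 2 / (M + 1)) (by positivity)
  refine ⟨F, fun s hs => ?_⟩
  have h1 := hF s hs
  rw [Real.norm_of_nonneg (by positivity), lt_div_iff₀ (by positivity)] at h1
  refine lt_of_pow_lt_pow_left₀ 2 hε.le ((ha.norm_sum_smul_sq_le hM s c).trans_lt ?_)
  have : 0 ≤ ∑ i ∈ s, ‖c i‖ ^ 2 := by positivity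
  nlinarith

/-- The row need only be bounded: the tails of the column alone make the partial sums Cauchy. -/
lemma IsBoundedRow.summable_mul {M : ℝ} {a b : ι → H →L[ℂ] H} (hM : 0 ≤ M)
    (ha : IsBoundedRow M a) (hb : IsVanishingColumn b) : Summable fun i => a i * b i := by
  rw [summable_iff_vanishing_norm]
  intro ε hε
  obtain ⟨F, hF⟩ := hb ((ε / 2) ^ 2 / (M + 1)) (by positivity)
  -- The operator norm bound gives only `≤`; aiming at `ε / 2` recovers the strict inequality.
  refine ⟨F, fun s hs => lt_of_le_of_lt ?_ (half_lt_self hε)⟩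
  refine ContinuousLinearMap.opNorm_le_bound _ (by positivity) fun ξ => ?_
  refine le_of_sq_le_sq ?_ (by positivity)
  have h1 := ha s fun i => b i ξ
  have h2 := hF s hs ξ
  have h3 : M * (((ε / 2) ^ 2 / (M + 1)) * ‖ξ‖ ^ 2) ≤ (ε / 2 * ‖ξ‖) ^ 2 := by
    rw [mul_pow, ← mul_assoc]
    gcongr
    rw [mul_div_assoc', div_le_iff₀ (by positivity)]
    nlinarith [sq_nonneg (ε / 2)]
  simp only [sum_apply]
  exact h1.trans ((mul_le_mul_of_nonneg_left h2 hM).trans h3)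

/-- The map `ℓ² → B(H)`, `c ↦ ∑ cᵢ aᵢ`, given by a bounded row of operators. -/
def rowMap {M : ℝ} {a : ι → H →L[ℂ] H} (hM : 0 ≤ M) (ha : IsBoundedRow M a) :
    lp (fun _ : ι => ℂ) 2 →L[ℂ] (H →L[ℂ] H) :=
  LinearMap.mkContinuous
    { toFun := fun c => ∑' i, c i • a i
      map_add' := fun c d => by
        rw [← (ha.summable_smul hM (lp_two_hasSum_sq c).summable).tsum_add
          (ha.summable_smul hM (lp_two_hasSum_sq d).summable)]
        simp [add_smul]
      map_smul' := fun k c => by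
        rw [RingHom.id_apply, ← (ha.summable_smul hM (lp_two_hasSum_sq c).summable).tsum_const_smul]
        simp [smul_smul] }
    (√M) fun c => by
      refine le_of_tendsto ((ha.summable_smul hM (lp_two_hasSum_sq c).summable).hasSum.norm)
        (Filter.Eventually.of_forall fun s => ?_)
      refine le_of_sq_le_sq ((ha.norm_sum_smul_sq_le hM s c).trans ?_) (by positivity)
      rw [mul_pow, Real.sq_sqrt hM]
      exact mul_le_mul_of_nonneg_left (lp_two_sum_sq_le c s) hM

lemma hasSum_rowMap {M : ℝ} {a : ι → H →L[ℂ] H} (hM : 0 ≤ M) (ha : IsBoundedRow M a)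
    (c : lp (fun _ : ι => ℂ) 2) : HasSum (fun i => c i • a i) (rowMap hM ha c) :=
  (ha.summable_smul hM (lp_two_hasSum_sq c).summable).hasSum

/-! ### Coefficient vectors in `ℓ²` and the projection argument. -/

/-- The matrix coefficients `⟪η, bᵢ ξ⟫` of a vanishing column, as an element of `ℓ²`. -/
def coefficient {b : ι → H →L[ℂ] H} (hb : IsVanishingColumn b) (ξ η : H) :
    lp (fun _ : ι => ℂ) 2 :=
  ⟨fun i => ⟪η, b i ξ⟫_ℂ, memℓp_gen <| by
    refine Summable.of_nonneg_of_le (fun _ => by positivity) (fun i => ?_)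
      ((hb.summable ξ).mul_left (‖η‖ ^ 2))
    have := pow_le_pow_left₀ (norm_nonneg _) (norm_inner_le_norm (𝕜 := ℂ) η (b i ξ)) 2
    simpa [mul_pow] using this⟩

@[simp] lemma coefficient_apply {b : ι → H →L[ℂ] H} (hb : IsVanishingColumn b) (ξ η : H) (i : ι) :
    coefficient hb ξ η i = ⟪η, b i ξ⟫_ℂ := rfl

/-- Subtracting the finite sum deletes the coordinates in `F`, leaving the coefficients of the tail
of the column. Bessel's inequality in `k`, applied to each `bⱼ ξ` with `j ∉ F`, bounds these by the
tail itself. -/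
lemma sum_norm_sq_coefficient_sub_le [DecidableEq ι] {b : ι → H →L[ℂ] H}
    (hb : IsVanishingColumn b) {F : Finset ι} {ε : ℝ} {ξ : H}
    (hF : ∀ s : Finset ι, Disjoint s F → ∑ i ∈ s, ‖b i ξ‖ ^ 2 ≤ ε * ‖ξ‖ ^ 2)
    {κ : Type*} [Fintype κ] {η : κ → H} (hη : Orthonormal ℂ η) :
    ∑ k, ‖coefficient hb ξ (η k) - ∑ i ∈ F, ⟪η k, b i ξ⟫_ℂ • lp.single 2 i (1 : ℂ)‖ ^ 2 ≤
      ε * ‖ξ‖ ^ 2 := by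
  have h1 := hasSum_sum (s := Finset.univ) fun k (_ : k ∈ Finset.univ) => lp_two_hasSum_sq
    (coefficient hb ξ (η k) - ∑ i ∈ F, ⟪η k, b i ξ⟫_ℂ • lp.single 2 i (1 : ℂ))
  refine hasSum_le_of_sum_le h1 fun s => ?_
  have hval : ∀ k j, (coefficient hb ξ (η k) -
      ∑ i ∈ F, ⟪η k, b i ξ⟫_ℂ • lp.single 2 i (1 : ℂ) : lp (fun _ : ι => ℂ) 2) j =
      if j ∈ F then 0 else ⟪η k, b j ξ⟫_ℂ := by
    intro k j
    rw [lp.coeFn_sub, Pi.sub_apply, lp.coeFn_sum, Finset.sum_apply]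
    simp [Pi.single_apply]
    split_ifs <;> simp
  refine le_trans ?_ (hF (s \ F) Finset.sdiff_disjoint)
  have h2 : ∑ j ∈ s \ F, ∑ k, ‖⟪η k, b j ξ⟫_ℂ‖ ^ 2 ≤ ∑ i ∈ s \ F, ‖b i ξ‖ ^ 2 :=
    Finset.sum_le_sum fun i _ => hη.sum_inner_products_le (b i ξ)
  refine le_trans (le_of_eq ?_) h2
  rw [← Finset.sum_subset Finset.sdiff_subset]
  · refine Finset.sum_congr rfl fun j hj => Finset.sum_congr rfl fun k _ => ?_
    rw [hval, if_neg (Finset.mem_sdiff.mp hj).2]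
  · intro j hj hj'
    refine Finset.sum_eq_zero fun k _ => ?_
    rw [hval, if_pos (by simpa [hj] using hj')]
    simp

/-- Since `P ⊗ 1` fixes the column `(bⱼ ξ)`, the vectors on the left are the coordinates of `P ⊗ 1`
applied to the tail of the column outside `F`, and `P` is a contraction. Here `P` is the projection
onto `K`. -/
lemma sum_norm_sq_sub_projection_le [DecidableEq ι] {b : ι → H →L[ℂ] H}
    (hb : IsVanishingColumn b) {F : Finset ι} {ε : ℝ} {ξ : H}
    (hF : ∀ s : Finset ι, Disjoint s F → ∑ i ∈ s, ‖b i ξ‖ ^ 2 ≤ ε * ‖ξ‖ ^ 2)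
    (K : Submodule ℂ (lp (fun _ : ι => ℂ) 2)) [K.HasOrthogonalProjection]
    (hK : ∀ η, coefficient hb ξ η ∈ K) (J : Finset ι) :
    ∑ j ∈ J, ‖b j ξ - ∑ i ∈ F, K.starProjection (lp.single 2 i (1 : ℂ)) j • b i ξ‖ ^ 2 ≤
      ε * ‖ξ‖ ^ 2 := by
  set z : ι → H := fun j =>
    b j ξ - ∑ i ∈ F, K.starProjection (lp.single 2 i (1 : ℂ)) j • b i ξ with hz
  -- Working in the finite dimensional span of the relevant vectors avoids the Hilbert space `ℓ² ⊗
  -- H`: Parseval in `W` is exact for the `z j`, while Bessel suffices for the `bⱼ ξ`, which may lie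
  -- outside `W`.
  let W : Submodule ℂ H := Submodule.span ℂ (z '' (J : Set ι))
  have : FiniteDimensional ℂ W := FiniteDimensional.span_of_finite ℂ (J.finite_toSet.image z)
  have hzW : ∀ j ∈ J, z j ∈ W := fun j hj =>
    Submodule.subset_span (Set.mem_image_of_mem z hj)
  let e := stdOrthonormalBasis ℂ W
  have he : Orthonormal ℂ fun k => (e k : H) := by
    exact e.orthonormal.comp_linearIsometry W.subtypeₗᵢ
  refine le_trans ?_ (sum_norm_sq_coefficient_sub_le hb hF he)
  have hsq : ∀ j ∈ J, ‖z j‖ ^ 2 = ∑ k, ‖⟪(e k : H), z j⟫_ℂ‖ ^ 2 := fun j hj =>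
    (e.sum_sq_norm_inner_right (⟨z j, hzW j hj⟩ : W)).symm
  rw [Finset.sum_congr rfl hsq, Finset.sum_comm]
  refine Finset.sum_le_sum fun k _ => ?_
  set x := coefficient hb ξ (e k : H) -
    ∑ i ∈ F, ⟪(e k : H), b i ξ⟫_ℂ • lp.single 2 i (1 : ℂ) with hx
  -- This is where `hK` enters: `P` leaves the coefficient vector unchanged and acts only on the
  -- basis vectors that are subtracted.
  have hPx : ∀ j, ⟪(e k : H), z j⟫_ℂ = K.starProjection x j := by
    intro j
    rw [hx, map_sub, Submodule.starProjection_eq_self_iff.mpr (hK _), map_sum, lp.coeFn_sub,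
      Pi.sub_apply, lp.coeFn_sum, Finset.sum_apply, hz, inner_sub_right, inner_sum]
    simp [inner_smul_right, mul_comm]
  simp only [hPx]
  refine (lp_two_sum_sq_le _ J).trans ?_
  exact pow_le_pow_left₀ (norm_nonneg _) (K.norm_starProjection_apply_le x) 2

/-- Let `∑ aᵢ ⊗ bᵢ` be a convergent Haagerup representation. A closed subspace of `B(H)`, stable
under right multiplication by the `bᵢ`, which contains all left slices `∑ ⟪η, bᵢ ξ⟫ aᵢ`, also
contains the product `∑ aᵢ bᵢ`. -/
theorem IsBoundedRow.product_mem {M : ℝ} {a b : ι → H →L[ℂ] H} (hM : 0 ≤ M)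
    (ha : IsBoundedRow M a) (hb : IsVanishingColumn b) (X : Submodule ℂ (H →L[ℂ] H))
    (hX : IsClosed (X : Set (H →L[ℂ] H))) (hXb : ∀ x ∈ X, ∀ i, x * b i ∈ X)
    (hslice : ∀ ξ η, rowMap hM ha (coefficient hb ξ η) ∈ X) {m : H →L[ℂ] H}
    (hm : HasSum (fun i => a i * b i) m) : m ∈ X := by
  classical
  let K : Submodule ℂ (lp (fun _ : ι => ℂ) 2) := X.comap (rowMap hM ha).toLinearMap
  have hKc : IsClosed (K : Set (lp (fun _ : ι => ℂ) 2)) :=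
    hX.preimage (rowMap hM ha).continuous
  have : CompleteSpace K := hKc.completeSpace_coe
  have hP : ∀ i, rowMap hM ha (K.starProjection (lp.single 2 i (1 : ℂ))) ∈ X := fun i =>
    K.starProjection_apply_mem (lp.single 2 i (1 : ℂ))
  rw [← SetLike.mem_coe, ← hX.closure_eq, Metric.mem_closure_iff]
  intro ε hε
  obtain ⟨F, hF⟩ := hb ((ε / 2) ^ 2 / (M + 1)) (by positivity)
  refine ⟨∑ i ∈ F, rowMap hM ha (K.starProjection (lp.single 2 i (1 : ℂ))) * b i,
    X.sum_mem fun i _ => hXb _ (hP i) i, ?_⟩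
  rw [dist_eq_norm]
  refine lt_of_le_of_lt ?_ (half_lt_self hε)
  refine ContinuousLinearMap.opNorm_le_bound _ (by positivity) fun ξ => ?_
  -- Both operators are expanded along the same row `a`, so the row bound turns the `ℓ²` estimate on
  -- the column error into a norm estimate.
  have h1 : HasSum (fun j => a j (b j ξ -
      ∑ i ∈ F, K.starProjection (lp.single 2 i (1 : ℂ)) j • b i ξ))
      ((m - ∑ i ∈ F, rowMap hM ha (K.starProjection (lp.single 2 i (1 : ℂ))) * b i) ξ) := by
    have e1 : HasSum (fun j => a j (b j ξ)) (m ξ) :=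
      hm.mapL (ContinuousLinearMap.apply ℂ H ξ)
    have e2 := hasSum_sum (s := F) fun i _ =>
      (hasSum_rowMap hM ha (K.starProjection (lp.single 2 i (1 : ℂ)))).mapL
        (ContinuousLinearMap.apply ℂ H (b i ξ))
    have e3 := e1.sub e2
    simpa [map_sub, map_sum] using e3
  refine le_of_tendsto h1.norm (Filter.Eventually.of_forall fun J => ?_)
  refine le_of_sq_le_sq ((ha J _).trans ?_) (by positivity)
  have h2 := sum_norm_sq_sub_projection_le hb (fun s hs => hF s hs ξ) K (fun η => hslice ξ η) J
  refine (mul_le_mul_of_nonneg_left h2 hM).trans ?_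
  rw [mul_pow, ← mul_assoc]
  gcongr
  rw [mul_div_assoc', div_le_iff₀ (by positivity)]
  nlinarith [sq_nonneg (ε / 2)]

end RowColumn

/-! ### Haagerup representations of tensors -/

variable {H : Type*} [NormedAddCommGroup H] [InnerProductSpace ℂ H]

lemma isBoundedRow_of_univ {κ : Type*} [Fintype κ] {M : ℝ} {a : κ → H →L[ℂ] H}
    (h : ∀ w : κ → H, ‖∑ i, a i (w i)‖ ^ 2 ≤ M * ∑ i, ‖w i‖ ^ 2) : IsBoundedRow M a := by
  classical
  intro s w
  have := h fun i => if i ∈ s then w i else 0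
  simpa [apply_ite, Finset.sum_ite_mem] using this

/-- Every tensor `v` with `N v < t` has a representation `v = ∑ aᵢ ⊗ bᵢ` whose row `(aᵢ)` and
column `(bᵢ)` have squared norms at most `t`; that is, `N` dominates the Haagerup norm. -/
def DominatesHaagerup {A : Subalgebra ℂ (H →L[ℂ] H)} (N : ModuleSeminorm A) : Prop :=
  ∀ v t, N.toSeminorm v < t → ∃ (κ : Type) (_ : Fintype κ) (a b : κ → A),
    v = ∑ i, a i ⊗ₜ[ℂ] b i ∧ IsBoundedRow t (fun i => (a i : H →L[ℂ] H)) ∧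
      ∀ ξ, ∑ i, ‖(b i : H →L[ℂ] H) ξ‖ ^ 2 ≤ t * ‖ξ‖ ^ 2

/-- Factor `α (x ⊗ y) β = (α (x ⊗ 1)) ((1 ⊗ y) β)` into a row and a column, indexed by the
intermediate pairs `(j, k)`. After balancing, `x` and `y` are contractions and `‖α‖²`, `‖β‖²` are at
most `t`. -/
theorem dominatesHaagerup_operatorProjectiveNorm (A : Subalgebra ℂ (H →L[ℂ] H)) :
    DominatesHaagerup (operatorProjectiveNorm A) := by
  intro v t ht
  obtain ⟨r, hr, hrt⟩ := exists_lt_of_csInf_lt (operatorProjectiveValues_nonempty v) ht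
  obtain ⟨p, q, α, β, x, y, rfl, hα, hβ, hx, hy⟩ := exists_balanced hr hrt
  have ht0 : 0 ≤ t := (sq_nonneg _).trans hα
  have hx2 : matrixNorm x ^ 2 ≤ 1 := pow_le_one₀ (matrixNorm_nonneg x) hx
  have hy2 : matrixNorm y ^ 2 ≤ 1 := pow_le_one₀ (matrixNorm_nonneg y) hy
  refine ⟨Fin p × Fin q, inferInstance, fun s => ∑ i, α (i, s.2) • x i s.1,
    fun s => ∑ l, β (s.1, l) • y s.2 l, ?_, isBoundedRow_of_univ fun w => ?_, fun ξ => ?_⟩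
  · simp only [rowKroneckerColumn, TensorProduct.sum_tmul, TensorProduct.tmul_sum,
      Fintype.sum_prod_type, ← TensorProduct.smul_tmul', TensorProduct.tmul_smul]
    calc _ = ∑ i, ∑ j, ∑ k, ∑ l, (α (i, k) * β (j, l)) • (x i j ⊗ₜ[ℂ] y k l) :=
          Finset.sum_congr rfl fun i _ => Finset.sum_comm
      _ = ∑ j, ∑ k, ∑ i, ∑ l, (α (i, k) * β (j, l)) • (x i j ⊗ₜ[ℂ] y k l) := by
          rw [Finset.sum_comm]
          exact Finset.sum_congr rfl fun j _ => Finset.sum_comm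
      _ = _ := by
          refine Finset.sum_congr rfl fun j _ => Finset.sum_congr rfl fun k _ => ?_
          rw [Finset.sum_comm]
          refine Finset.sum_congr rfl fun l _ => ?_
          rw [Finset.smul_sum]
          exact Finset.sum_congr rfl fun i _ => by rw [smul_smul, mul_comm]
  -- Here `z = (x ⊗ 1) w`, and `x ⊗ 1` acts separately for each second index `k`.
  · set z : Fin p × Fin q → H := fun s => ∑ j, (x s.1 j : H →L[ℂ] H) (w (j, s.2)) with hz
    have h1 : ∑ s : Fin p × Fin q, ((∑ i, α (i, s.2) • x i s.1 : A) : H →L[ℂ] H) (w s) =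
        ∑ s, α s • z s := by
      simp only [Fintype.sum_prod_type, hz, AddSubmonoidClass.coe_finsetSum, sum_apply,
        SetLike.val_smul, smul_apply, Finset.smul_sum]
      rw [Finset.sum_comm, Finset.sum_comm (s := (Finset.univ : Finset (Fin p)))
        (t := (Finset.univ : Finset (Fin q)))]
      exact Finset.sum_congr rfl fun k _ => Finset.sum_comm
    have h2 : ∑ s, ‖z s‖ ^ 2 ≤ ∑ s, ‖w s‖ ^ 2 := by
      rw [Fintype.sum_prod_type_right, Fintype.sum_prod_type_right]
      refine Finset.sum_le_sum fun k _ => (matrixNorm_spec x fun j => w (j, k)).trans ?_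
      exact mul_le_of_le_one_left (by positivity) hx2
    rw [h1]
    calc _ ≤ (∑ s, ‖α s‖ * ‖z s‖) ^ 2 := by
          gcongr
          refine (norm_sum_le _ _).trans_eq ?_
          simp only [norm_smul]
      _ ≤ (∑ s, ‖α s‖ ^ 2) * ∑ s, ‖z s‖ ^ 2 := Finset.sum_mul_sq_le_sq_mul_sq _ _ _
      _ ≤ t * ∑ s, ‖w s‖ ^ 2 := by
          rw [← EuclideanSpace.norm_sq_eq]
          gcongr
  · have h1 : ∀ j, ∑ k, ‖((∑ l, β (j, l) • y k l : A) : H →L[ℂ] H) ξ‖ ^ 2 ≤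
        ∑ l, ‖β (j, l) • ξ‖ ^ 2 := by
      intro j
      refine le_trans (le_of_eq ?_) ((matrixNorm_spec y fun l => β (j, l) • ξ).trans
        (mul_le_of_le_one_left (by positivity) hy2))
      simp
    rw [Fintype.sum_prod_type]
    refine (Finset.sum_le_sum fun j _ => h1 j).trans ?_
    simp only [norm_smul, mul_pow, ← Finset.sum_mul]
    rw [← Fintype.sum_prod_type (f := fun s => ‖β s‖ ^ 2), ← EuclideanSpace.norm_sq_eq]
    gcongr

lemma operatorProjectiveSeminorm_tmul_le {A : Subalgebra ℂ (H →L[ℂ] H)} (x y : A) :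
    operatorProjectiveSeminorm A (x ⊗ₜ y) ≤ ‖x‖ * ‖y‖ := by
  have hN : ∀ z : A, matrixNorm (Matrix.of fun _ _ : Fin 1 => z) ≤ ‖z‖ := fun z =>
    matrixNorm_le _ (norm_nonneg _) fun v => by
      have := pow_le_pow_left₀ (norm_nonneg _) ((z : H →L[ℂ] H).le_opNorm (v 0)) 2
      exact le_of_eq_of_le (by simp) (this.trans_eq ((mul_pow ‖z‖ ‖v 0‖ 2).trans (by simp)))
  refine (csInf_le ⟨0, operatorProjectiveValues_nonneg _⟩ ⟨1, 1, WithLp.toLp 2 fun _ => 1,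
    WithLp.toLp 2 fun _ => 1, Matrix.of fun _ _ => x, Matrix.of fun _ _ => y,
    by simp [rowKroneckerColumn], rfl⟩).trans ?_
  have h1 := mul_le_mul (hN x) (hN y) (matrixNorm_nonneg _) (norm_nonneg _)
  simpa [EuclideanSpace.norm_eq] using h1

/-- The projective norm is the largest seminorm bounded by `‖x‖ ‖y‖` on elementary tensors.
Domination of the Haagerup norm thus passes to it. -/
lemma operatorProjectiveSeminorm_le_projectiveSeminorm {A : Subalgebra ℂ (H →L[ℂ] H)}
    (u : A ⊗[ℂ] A) : operatorProjectiveSeminorm A u ≤ projectiveSeminorm A u := by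
  refine le_csInf (projectiveValues_nonempty u) ?_
  rintro _ ⟨n, a, b, rfl, rfl⟩
  exact (Finset.le_sum_of_subadditive (operatorProjectiveSeminorm A)
    (operatorProjectiveSeminorm A).map_zero'.le (operatorProjectiveSeminorm A).add_le' _ _).trans
    (Finset.sum_le_sum fun i _ => operatorProjectiveSeminorm_tmul_le _ _)

theorem dominatesHaagerup_projectiveNorm (A : Subalgebra ℂ (H →L[ℂ] H)) :
    DominatesHaagerup (projectiveNorm A) := fun v t ht =>
  dominatesHaagerup_operatorProjectiveNorm A v t
    ((operatorProjectiveSeminorm_le_projectiveSeminorm v).trans_lt ht)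

/-! ### Slice maps and series representations in the completion -/

variable {A : Subalgebra ℂ (H →L[ℂ] H)} {N : ModuleSeminorm A}

lemma ModuleSeminorm.nonneg (N : ModuleSeminorm A) (v : A ⊗[ℂ] A) : 0 ≤ N.toSeminorm v :=
  (norm_nonneg _).trans (N.norm_productMap_le v)

/-- The map from `A ⊗ A` to its completion for the norm `N`. -/
def toCompletedTensor (N : ModuleSeminorm A) : A ⊗[ℂ] A →ₗ[ℂ] CompletedTensor N :=
  (UniformSpace.Completion.toComplL (𝕜 := ℂ) (E := NormedTensor N)).toLinearMap ∘ₗ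
    (LinearMap.id : NormedTensor N →ₗ[ℂ] NormedTensor N)

lemma toCompletedTensor_apply (v : NormedTensor N) :
    toCompletedTensor N v = (v : CompletedTensor N) := rfl

/-- The slice map `a ⊗ b ↦ ⟪η, b ξ⟫ a`. -/
def sliceMap (A : Subalgebra ℂ (H →L[ℂ] H)) (ξ η : H) : A ⊗[ℂ] A →ₗ[ℂ] (H →L[ℂ] H) :=
  TensorProduct.lift (LinearMap.flip
    { toFun := fun b => ⟪η, (b : H →L[ℂ] H) ξ⟫_ℂ • A.val.toLinearMap
      map_add' := fun b c => by simp [add_smul]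
      map_smul' := fun k b => by simp [smul_smul] })

@[simp] lemma sliceMap_tmul (ξ η : H) (a b : A) :
    sliceMap A ξ η (a ⊗ₜ b) = ⟪η, (b : H →L[ℂ] H) ξ⟫_ℂ • (a : H →L[ℂ] H) := by
  simp [sliceMap]

lemma sliceMap_leftAction (ξ η : H) (a : A) (v : A ⊗[ℂ] A) :
    sliceMap A ξ η (leftAction a v) = (a : H →L[ℂ] H) * sliceMap A ξ η v := by
  induction v with
  | zero => simp
  | tmul x y => simp
  | add u v hu hv => simp [hu, hv, mul_add]

/-- The right action moves onto the vector `ξ`, whereas the left action stays outside the slice; the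
diagonal identity equates the two. -/
lemma sliceMap_rightAction (ξ η : H) (a : A) (v : A ⊗[ℂ] A) :
    sliceMap A ξ η (rightAction a v) = sliceMap A ((a : H →L[ℂ] H) ξ) η v := by
  induction v with
  | zero => simp
  | tmul x y => simp
  | add u v hu hv => simp [hu, hv]

/-- In a Haagerup representation the slice is the row applied to the scalars `⟪η, bᵢ ξ⟫`, whose `ℓ²`
norm is controlled by the column. -/
lemma DominatesHaagerup.norm_sliceMap_le (hN : DominatesHaagerup N) (ξ η : H) (v : A ⊗[ℂ] A) :
    ‖sliceMap A ξ η v‖ ≤ ‖ξ‖ * ‖η‖ * N.toSeminorm v := by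
  have key : ∀ t, N.toSeminorm v < t → ‖sliceMap A ξ η v‖ ≤ ‖ξ‖ * ‖η‖ * t := by
    intro t ht
    have ht0 : 0 ≤ t := (N.nonneg v).trans ht.le
    obtain ⟨κ, _, a, b, rfl, ha, hb⟩ := hN v t ht
    refine le_of_sq_le_sq ?_ (by positivity)
    have h1 := ha.norm_sum_smul_sq_le ht0 Finset.univ fun i => ⟪η, (b i : H →L[ℂ] H) ξ⟫_ℂ
    rw [map_sum]
    simp only [sliceMap_tmul]
    refine h1.trans ?_
    have h2 : ∑ i, ‖⟪η, (b i : H →L[ℂ] H) ξ⟫_ℂ‖ ^ 2 ≤ ‖η‖ ^ 2 * (t * ‖ξ‖ ^ 2) := by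
      refine le_trans ?_ (mul_le_mul_of_nonneg_left (hb ξ) (sq_nonneg ‖η‖))
      rw [Finset.mul_sum]
      refine Finset.sum_le_sum fun i _ => ?_
      rw [← mul_pow]
      exact pow_le_pow_left₀ (norm_nonneg _) (norm_inner_le_norm _ _) 2
    calc _ ≤ t * (‖η‖ ^ 2 * (t * ‖ξ‖ ^ 2)) := by gcongr
      _ = _ := by ring
  refine le_of_forall_pos_le_add fun ε hε => ?_
  have h := key (N.toSeminorm v + ε / (‖ξ‖ * ‖η‖ + 1)) (lt_add_of_pos_right _ (by positivity))
  refine h.trans ?_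
  rw [mul_add]
  gcongr
  rw [mul_div_assoc', div_le_iff₀ (by positivity)]
  nlinarith [mul_nonneg (norm_nonneg ξ) (norm_nonneg η)]

/-- The slice map as a bounded map on `A ⊗ A` with the norm `N`. -/
def sliceCLM (hN : DominatesHaagerup N) (ξ η : H) : NormedTensor N →L[ℂ] (H →L[ℂ] H) :=
  LinearMap.mkContinuous (E := NormedTensor N) (sliceMap A ξ η) (‖ξ‖ * ‖η‖)
    (hN.norm_sliceMap_le ξ η)

lemma norm_sliceCLM_le (hN : DominatesHaagerup N) (ξ η : H) : ‖sliceCLM hN ξ η‖ ≤ ‖ξ‖ * ‖η‖ :=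
  LinearMap.mkContinuous_norm_le _ (by positivity) _

lemma sliceCLM_apply (hN : DominatesHaagerup N) (ξ η : H) (v : NormedTensor N) :
    sliceCLM hN ξ η v = sliceMap A ξ η v := rfl

/-! ### Concatenating countably many finite rows and columns. -/

section Sigma

variable {κ : ℕ → Type} [∀ n, Fintype (κ n)] {t : ℕ → ℝ}

lemma subset_image_fst_sigma [∀ n, DecidableEq (κ n)] (s : Finset (Σ n, κ n)) :
    s ⊆ (s.image Sigma.fst).sigma fun _ => Finset.univ := fun i hi => by
  simpa using ⟨i.2, hi⟩

/-- Each block contributes at most `√(t n)` times the `ℓ²` norm of its input; Cauchy–Schwarz over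
the blocks adds the squared constants `t n`. -/
lemma isBoundedRow_sigma (ht : ∀ n, 0 ≤ t n) (hts : Summable t) {a : (Σ n, κ n) → H →L[ℂ] H}
    (ha : ∀ n, IsBoundedRow (t n) fun i => a ⟨n, i⟩) : IsBoundedRow (∑' n, t n) a := by
  classical
  intro s w
  -- Extending `w` by zero replaces an arbitrary finite index set by whole blocks.
  set w' : (Σ n, κ n) → H := fun i => if i ∈ s then w i else 0 with hw'
  set T := s.image Sigma.fst with hT
  have e1 : ∑ i ∈ s, a i (w i) = ∑ n ∈ T, ∑ k, a ⟨n, k⟩ (w' ⟨n, k⟩) := by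
    rw [← Finset.sum_sigma (f := fun i => a i (w' i)),
      ← Finset.sum_subset (subset_image_fst_sigma s)]
    · exact Finset.sum_congr rfl fun i hi => by simp [hw', hi]
    · exact fun i _ hi => by simp [hw', hi]
  have e2 : ∑ i ∈ s, ‖w i‖ ^ 2 = ∑ n ∈ T, ∑ k, ‖w' ⟨n, k⟩‖ ^ 2 := by
    rw [← Finset.sum_sigma (f := fun i => ‖w' i‖ ^ 2),
      ← Finset.sum_subset (subset_image_fst_sigma s)]
    · exact Finset.sum_congr rfl fun i hi => by simp [hw', hi]
    · exact fun i _ hi => by simp [hw', hi]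
  rw [e1, e2]
  calc _ ≤ (∑ n ∈ T, √(t n) * √(∑ k, ‖w' ⟨n, k⟩‖ ^ 2)) ^ 2 := by
        gcongr
        refine (norm_sum_le _ _).trans (Finset.sum_le_sum fun n _ => ?_)
        rw [← Real.sqrt_mul (ht n)]
        exact Real.le_sqrt_of_sq_le (ha n Finset.univ fun k => w' ⟨n, k⟩)
    _ ≤ (∑ n ∈ T, √(t n) ^ 2) * ∑ n ∈ T, √(∑ k, ‖w' ⟨n, k⟩‖ ^ 2) ^ 2 :=
        Finset.sum_mul_sq_le_sq_mul_sq _ _ _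
    _ = (∑ n ∈ T, t n) * ∑ n ∈ T, ∑ k, ‖w' ⟨n, k⟩‖ ^ 2 := by
        congr 1
        · exact Finset.sum_congr rfl fun n _ => Real.sq_sqrt (ht n)
        · exact Finset.sum_congr rfl fun n _ => Real.sq_sqrt (by positivity)
    _ ≤ _ := by
        gcongr
        exact hts.sum_le_tsum _ fun n _ => ht n

lemma isVanishingColumn_sigma (hts : Summable t) {b : (Σ n, κ n) → H →L[ℂ] H}
    (hb : ∀ n ξ, ∑ i, ‖b ⟨n, i⟩ ξ‖ ^ 2 ≤ t n * ‖ξ‖ ^ 2) : IsVanishingColumn b := by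
  classical
  intro ε hε
  obtain ⟨G, hG⟩ := summable_iff_vanishing_norm.mp hts ε hε
  refine ⟨G.sigma fun _ => Finset.univ, fun s hs ξ => ?_⟩
  have hdisj : Disjoint (s.image Sigma.fst) G := by
    rw [Finset.disjoint_left] at hs ⊢
    intro n hn hnG
    obtain ⟨i, hi, rfl⟩ := Finset.mem_image.mp hn
    exact hs hi (by simpa using hnG)
  calc _ ≤ ∑ i ∈ (s.image Sigma.fst).sigma fun _ => Finset.univ, ‖b i ξ‖ ^ 2 :=
        Finset.sum_le_sum_of_subset_of_nonneg (subset_image_fst_sigma s)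
          fun _ _ _ => sq_nonneg _
    _ = ∑ n ∈ s.image Sigma.fst, ∑ k, ‖b ⟨n, k⟩ ξ‖ ^ 2 := Finset.sum_sigma _ _ _
    _ ≤ ∑ n ∈ s.image Sigma.fst, t n * ‖ξ‖ ^ 2 := Finset.sum_le_sum fun n _ => hb n ξ
    _ = (∑ n ∈ s.image Sigma.fst, t n) * ‖ξ‖ ^ 2 := (Finset.sum_mul _ _ _).symm
    _ ≤ ε * ‖ξ‖ ^ 2 := by
        gcongr
        exact (le_abs_self _).trans (hG _ hdisj).le

end Sigma

/-- Every element of the completion has a series representation `∑ aᵢ ⊗ bᵢ` with a bounded row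
`a` and a column `b` whose squares are summable; bounded maps may be evaluated on it whenever
the resulting series is summable. -/
theorem DominatesHaagerup.exists_series (hN : DominatesHaagerup N) (u : CompletedTensor N) :
    ∃ (ι : Type) (a b : ι → A) (M : ℝ), 0 ≤ M ∧
      IsBoundedRow M (fun i => (a i : H →L[ℂ] H)) ∧
      IsVanishingColumn (fun i => (b i : H →L[ℂ] H)) ∧
      ∀ (f : CompletedTensor N →L[ℂ] (H →L[ℂ] H)) (g : ι → H →L[ℂ] H),
        (∀ i, f (toCompletedTensor N (a i ⊗ₜ b i)) = g i) → Summable g →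
          HasSum g (f u) := by
  obtain ⟨v, hv, -, hv1⟩ := controlled_sum_of_mem_closure_range
    (j := (UniformSpace.Completion.toCompl (α := NormedTensor N))) (b := u)
    (UniformSpace.Completion.denseRange_coe u)
    (f := fun n => (1 / 2 : ℝ) ^ n) (fun n => by positivity)
  obtain ⟨t, ht0, hts, htv⟩ : ∃ t : ℕ → ℝ, (∀ n, 0 ≤ t n) ∧ Summable t ∧
      ∀ n, N.toSeminorm (v n) < t n := by
    -- The approximation controls `v n` only for `n > 0`; the factor covers `v 0` and, being at
    -- least `1`, keeps the geometric bounds.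
    refine ⟨fun n => (N.toSeminorm (v 0) + 1) * (1 / 2) ^ n, fun n => ?_,
      summable_geometric_two.mul_left _, fun n => ?_⟩
    · have : 0 ≤ N.toSeminorm (v 0) := N.nonneg (v 0)
      positivity
    · have h0 : 0 ≤ N.toSeminorm (v 0) := N.nonneg (v 0)
      rcases Nat.eq_zero_or_pos n with rfl | hn
      · simp
      · have h1 : N.toSeminorm (v n) < (1 / 2 : ℝ) ^ n := by
          have := hv1 n hn
          rw [UniformSpace.Completion.toCompl_apply, UniformSpace.Completion.norm_coe] at this
          exact this
        have h2 : (0 : ℝ) < (1 / 2) ^ n := by positivity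
        nlinarith
  choose κ hκ a b hab ha hb using fun n => hN (v n) (t n) (htv n)
  refine ⟨Σ n, κ n, fun i => a i.1 i.2, fun i => b i.1 i.2, ∑' n, t n, tsum_nonneg ht0,
    isBoundedRow_sigma ht0 hts ha, isVanishingColumn_sigma hts hb, fun f g hg hgs => ?_⟩
  -- The terms `aᵢ ⊗ bᵢ` are not individually controlled in `N`: only the block sums `v n` add up to
  -- `u`. The assumed summability of `g` permits regrouping by blocks.
  have h1 : HasSum (fun n => f (v n : CompletedTensor N)) (∑' i, g i) := by
    refine hgs.hasSum.sigma fun n => ?_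
    have : f (v n : CompletedTensor N) = ∑ k, g ⟨n, k⟩ := by
      rw [← toCompletedTensor_apply, hab n, map_sum, map_sum]
      exact Finset.sum_congr rfl fun k _ => hg ⟨n, k⟩
    rw [this]
    exact hasSum_fintype _
  have h2 : Filter.Tendsto (fun n => ∑ i ∈ Finset.range (n + 1), f (v i : CompletedTensor N))
      Filter.atTop (nhds (f u)) := by
    have := (f.continuous.tendsto u).comp hv
    refine this.congr fun n => ?_
    simp [map_sum]
  have h3 := h1.tendsto_sum_nat.comp (Filter.tendsto_add_atTop_nat 1)
  rw [tendsto_nhds_unique h2 h3]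
  exact hgs.hasSum

/-! ### Finite rank approximation of left multiplications -/

lemma finiteDimensional_range_add {V W : Type*} [AddCommGroup V] [Module ℂ V] [AddCommGroup W]
    [Module ℂ W] (f g : V →ₗ[ℂ] W) [FiniteDimensional ℂ f.range] [FiniteDimensional ℂ g.range] :
    FiniteDimensional ℂ (f + g).range := by
  refine Submodule.finiteDimensional_of_le (S₂ := f.range ⊔ g.range) ?_
  rintro _ ⟨x, rfl⟩
  exact Submodule.add_mem_sup ⟨x, rfl⟩ ⟨x, rfl⟩

lemma finiteDimensional_range_comp {V W Z : Type*} [AddCommGroup V] [Module ℂ V] [AddCommGroup W]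
    [Module ℂ W] [AddCommGroup Z] [Module ℂ Z] (g : W →ₗ[ℂ] Z) (f : V →ₗ[ℂ] W)
    [FiniteDimensional ℂ f.range] : FiniteDimensional ℂ (g ∘ₗ f).range := by
  rw [LinearMap.range_comp]
  infer_instance

/-- The operators `x` for which `a ↦ a x`, as a map `A → B(H)`, is a norm limit of finite rank
maps. -/
def approximableSubmodule (A : Subalgebra ℂ (H →L[ℂ] H)) : Submodule ℂ (H →L[ℂ] H) where
  carrier := {x | ∀ ε > 0, ∃ F : A →ₗ[ℂ] (H →L[ℂ] H), FiniteDimensional ℂ F.range ∧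
    ∀ a : A, ‖(a : H →L[ℂ] H) * x - F a‖ ≤ ε * ‖a‖}
  zero_mem' := fun ε hε => ⟨0, by rw [LinearMap.range_zero]; infer_instance, fun a => by
    simp only [mul_zero, LinearMap.zero_apply, sub_zero, norm_zero]; positivity⟩
  add_mem' := fun {x y} hx hy ε hε => by
    obtain ⟨F, _, hF⟩ := hx (ε / 2) (half_pos hε)
    obtain ⟨G, _, hG⟩ := hy (ε / 2) (half_pos hε)
    refine ⟨F + G, finiteDimensional_range_add F G, fun a => ?_⟩
    rw [mul_add, LinearMap.add_apply, add_sub_add_comm]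
    linarith [norm_add_le ((a : H →L[ℂ] H) * x - F a) ((a : H →L[ℂ] H) * y - G a), hF a, hG a]
  smul_mem' := fun c x hx ε hε => by
    obtain ⟨F, _, hF⟩ := hx (ε / (‖c‖ + 1)) (by positivity)
    refine ⟨LinearMap.lsmul ℂ _ c ∘ₗ F, finiteDimensional_range_comp _ F, fun a => ?_⟩
    rw [mul_smul_comm, LinearMap.comp_apply, LinearMap.lsmul_apply, ← smul_sub, norm_smul]
    refine (mul_le_mul_of_nonneg_left (hF a) (norm_nonneg c)).trans ?_
    rw [← mul_assoc]
    gcongr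
    rw [mul_div_assoc', div_le_iff₀ (by positivity)]
    nlinarith

lemma mul_mem_approximableSubmodule {x : H →L[ℂ] H} (hx : x ∈ approximableSubmodule A)
    (y : H →L[ℂ] H) : x * y ∈ approximableSubmodule A := fun ε hε => by
  obtain ⟨F, _, hF⟩ := hx (ε / (‖y‖ + 1)) (by positivity)
  refine ⟨LinearMap.mulRight ℂ y ∘ₗ F, finiteDimensional_range_comp _ F, fun a => ?_⟩
  rw [LinearMap.comp_apply, LinearMap.mulRight_apply, ← mul_assoc, ← sub_mul]
  refine (norm_mul_le _ _).trans ((mul_le_mul_of_nonneg_right (hF a) (norm_nonneg y)).trans ?_)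
  rw [mul_right_comm]
  gcongr
  rw [div_mul_eq_mul_div, div_le_iff₀ (by positivity)]
  nlinarith

lemma isClosed_approximableSubmodule :
    IsClosed (approximableSubmodule A : Set (H →L[ℂ] H)) := by
  refine isClosed_of_closure_subset fun x hx ε hε => ?_
  obtain ⟨y, hy, hxy⟩ := Metric.mem_closure_iff.mp hx (ε / 2) (half_pos hε)
  obtain ⟨F, hFr, hF⟩ := hy (ε / 2) (half_pos hε)
  refine ⟨F, hFr, fun a => ?_⟩
  rw [dist_eq_norm] at hxy
  have h1 : ‖(a : H →L[ℂ] H) * (x - y)‖ ≤ ‖a‖ * (ε / 2) :=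
    (norm_mul_le _ _).trans (mul_le_mul_of_nonneg_left hxy.le (norm_nonneg _))
  have h2 := norm_add_le ((a : H →L[ℂ] H) * (x - y)) ((a : H →L[ℂ] H) * y - F a)
  rw [mul_sub, sub_add_sub_cancel, ← mul_sub] at h2
  linarith [hF a]

/-- If `1` is approximable then the inclusion of `A` is within `1/2` of a finite rank map, which
is therefore injective. -/
lemma finiteDimensional_of_one_mem (h : (1 : H →L[ℂ] H) ∈ approximableSubmodule A) :
    FiniteDimensional ℂ A := by
  obtain ⟨F, _, hF⟩ := h (1 / 2) (by norm_num)
  have hinj : Function.Injective F.rangeRestrict := by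
    rw [← LinearMap.ker_eq_bot, LinearMap.ker_rangeRestrict, LinearMap.ker_eq_bot']
    intro a ha
    have h1 := hF a
    rw [ha, mul_one, sub_zero] at h1
    have h2 : ‖(a : H →L[ℂ] H)‖ ≤ 1 / 2 * ‖(a : H →L[ℂ] H)‖ := h1
    exact Subtype.ext (norm_le_zero_iff.mp (by linarith))
  exact FiniteDimensional.of_injective _ hinj

/-- For `v = x ⊗ y` the map is `a ↦ ⟪η, y a ξ⟫ x`, of rank at most one. -/
lemma exists_finiteRank_sliceMap (ξ η : H) (v : A ⊗[ℂ] A) :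
    ∃ F : A →ₗ[ℂ] (H →L[ℂ] H), FiniteDimensional ℂ F.range ∧
      ∀ a : A, F a = sliceMap A ((a : H →L[ℂ] H) ξ) η v := by
  induction v with
  | zero => exact ⟨0, by rw [LinearMap.range_zero]; infer_instance, by simp⟩
  | tmul x y =>
    let φ : A →ₗ[ℂ] ℂ :=
      { toFun := fun a => ⟪η, (y : H →L[ℂ] H) ((a : H →L[ℂ] H) ξ)⟫_ℂ
        map_add' := fun a b => by simp
        map_smul' := fun k a => by simp }
    refine ⟨LinearMap.toSpanSingleton ℂ _ (x : H →L[ℂ] H) ∘ₗ φ, ?_, fun a => by simp [φ]⟩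
    exact finiteDimensional_range_comp _ φ
  | add u v hu hv =>
    obtain ⟨F, _, hF⟩ := hu
    obtain ⟨G, _, hG⟩ := hv
    exact ⟨F + G, finiteDimensional_range_add F G, fun a => by simp [hF, hG]⟩

/-! ### Slices of a diagonal, and the conclusion. -/

variable [CompleteSpace H]

lemma norm_fromCompletion_le {E F : Type*} [SeminormedAddCommGroup E] [NormedSpace ℂ E]
    [NormedAddCommGroup F] [NormedSpace ℂ F] [CompleteSpace F] (f : E →L[ℂ] F)
    (x : UniformSpace.Completion E) : ‖f.fromCompletion x‖ ≤ ‖f‖ * ‖x‖ := by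
  induction x using UniformSpace.Completion.induction_on with
  | hp => exact isClosed_le (by fun_prop) (by fun_prop)
  | ih x =>
    rw [ContinuousLinearMap.fromCompletion_apply_coe, UniformSpace.Completion.norm_coe]
    exact f.le_opNorm x

lemma mul_slice_eq (hN : DominatesHaagerup N) (ξ η : H) (a : A) (u : CompletedTensor N) :
    (a : H →L[ℂ] H) * (sliceCLM hN ξ η).fromCompletion u =
      (sliceCLM hN ξ η).fromCompletion ((NormedTensor.leftCLM N a).completion u) := by
  induction u using UniformSpace.Completion.induction_on with
  | hp => exact isClosed_eq (by fun_prop) (by fun_prop)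
  | ih v =>
    simp only [ContinuousLinearMap.fromCompletion_apply_coe, ContinuousLinearMap.completion_apply_coe]
    exact (sliceMap_leftAction ξ η a v).symm

lemma slice_right_eq (hN : DominatesHaagerup N) (ξ η : H) (a : A) (u : CompletedTensor N) :
    (sliceCLM hN ξ η).fromCompletion ((NormedTensor.rightCLM N a).completion u) =
      (sliceCLM hN ((a : H →L[ℂ] H) ξ) η).fromCompletion u := by
  induction u using UniformSpace.Completion.induction_on with
  | hp => exact isClosed_eq (by fun_prop) (by fun_prop)
  | ih v =>
    simp only [ContinuousLinearMap.fromCompletion_apply_coe, ContinuousLinearMap.completion_apply_coe]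
    exact sliceMap_rightAction ξ η a v

/-- The diagonal identity turns left multiplication of the slice by `a` into the substitution `ξ ↦ a
ξ`. The slice bound then makes the error of replacing `u` by an algebraic tensor uniform in `a`, up
to the factor `‖a‖`. -/
lemma slice_mem_approximableSubmodule (hN : DominatesHaagerup N) {u : CompletedTensor N}
    (hu : IsDiagonal N u) (ξ η : H) :
    (sliceCLM hN ξ η).fromCompletion u ∈ approximableSubmodule A := by
  intro ε hε
  obtain ⟨_, ⟨v, rfl⟩, hv⟩ := Metric.mem_closure_iff.mp (UniformSpace.Completion.denseRange_coe u)
    (ε / (‖ξ‖ * ‖η‖ + 1)) (by positivity)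
  obtain ⟨F, hFr, hF⟩ := exists_finiteRank_sliceMap ξ η v
  refine ⟨F, hFr, fun a => ?_⟩
  rw [mul_slice_eq, hu.2 a, slice_right_eq, hF, ← sliceCLM_apply hN,
    ← ContinuousLinearMap.fromCompletion_apply_coe (sliceCLM hN _ η) v, ← map_sub]
  rw [dist_eq_norm] at hv
  have h1 : ‖sliceCLM hN ((a : H →L[ℂ] H) ξ) η‖ ≤ ‖a‖ * ‖ξ‖ * ‖η‖ :=
    (norm_sliceCLM_le hN _ η).trans
      (mul_le_mul_of_nonneg_right ((a : H →L[ℂ] H).le_opNorm ξ) (norm_nonneg η))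
  have h2 : ‖ξ‖ * ‖η‖ * (ε / (‖ξ‖ * ‖η‖ + 1)) ≤ ε := by
    rw [mul_div_assoc', div_le_iff₀ (by positivity)]
    nlinarith
  calc _ ≤ ‖a‖ * ‖ξ‖ * ‖η‖ * (ε / (‖ξ‖ * ‖η‖ + 1)) :=
        (norm_fromCompletion_le _ _).trans (by gcongr)
    _ = ‖a‖ * (‖ξ‖ * ‖η‖ * (ε / (‖ξ‖ * ‖η‖ + 1))) := by ring
    _ ≤ ε * ‖a‖ := by
        rw [mul_comm ε]
        gcongr

/-- An operator algebra with a diagonal, for a norm dominating the Haagerup norm, is finite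
dimensional. -/
theorem DominatesHaagerup.finiteDimensional (hN : DominatesHaagerup N) {u : CompletedTensor N}
    (hu : IsDiagonal N u) : FiniteDimensional ℂ A := by
  obtain ⟨ι, a, b, M, hM, ha, hb, hs⟩ := hN.exists_series u
  refine finiteDimensional_of_one_mem ?_
  have hone : HasSum (fun i => (a i : H →L[ℂ] H) * b i) 1 := by
    rw [← hu.1]
    refine hs _ _ (fun i => ?_) (ha.summable_mul hM hb)
    exact (ContinuousLinearMap.fromCompletion_apply_coe _ _).trans (productMap_tmul _ _)
  refine ha.product_mem hM hb _ isClosed_approximableSubmodule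
    (fun x hx i => mul_mem_approximableSubmodule hx _) (fun ξ η => ?_) hone
  have h1 := hasSum_rowMap hM ha (coefficient hb ξ η)
  have h2 := hs (sliceCLM hN ξ η).fromCompletion _ (fun i =>
    (ContinuousLinearMap.fromCompletion_apply_coe _ _).trans (sliceMap_tmul ξ η _ _)) h1.summable
  -- The slice computed from the series is the continuous slice of `u`, to which the diagonal
  -- identity applies.
  rw [h1.unique h2]
  exact slice_mem_approximableSubmodule hN hu ξ η

end OperatorAlgebraDiagonal

end

theorem mainTheorem5 {H : Type*} [NormedAddCommGroup H] [InnerProductSpace ℂ H] [CompleteSpace H]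
    (A : Subalgebra ℂ (H →L[ℂ] H))
    (h : (∃ u : OperatorAlgebraDiagonal.CompletedTensor (OperatorAlgebraDiagonal.projectiveNorm A),
          OperatorAlgebraDiagonal.IsDiagonal (OperatorAlgebraDiagonal.projectiveNorm A) u) ∨
      (∃ u : OperatorAlgebraDiagonal.CompletedTensor
            (OperatorAlgebraDiagonal.operatorProjectiveNorm A),
          OperatorAlgebraDiagonal.IsDiagonal (OperatorAlgebraDiagonal.operatorProjectiveNorm A) u)) :
    FiniteDimensional ℂ A := by
  rcases h with ⟨u, hu⟩ | ⟨u, hu⟩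
  · exact (OperatorAlgebraDiagonal.dominatesHaagerup_projectiveNorm A).finiteDimensional hu
  · exact (OperatorAlgebraDiagonal.dominatesHaagerup_operatorProjectiveNorm A).finiteDimensional hu
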